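/- Let $\mathscr{M}$ be the set of all isometry classes of non-empty compact metric spaces, equipped with the Gromov--Hausdorff distance. For a metric space $(X,d)$ write $B(x,r)$ for the closed ball with centre $x$ and radius $r$, and $\operatorname{diam} X$ for the diameter of $X$. The space $(X,d)$ is - *doubling* if there is $N\in\mathbb{N}$ such that for all $x\in X$ and $r>0$ there is a set $F\subseteq X$ with at most $N$ elements and $B(x,r)\subseteq\bigcup_{y\in F}B(y,r/2)$; - *uniformly disconnected* if there is $\delta>0$ such that $\delta\, d(z_1,z_N)\le\max_{1\le i\le N-1}d(z_i,z_{i+1})$ for every non-constant finite sequence $z_1,\dots,z_N$ in $X$; - *uniformly perfect* if there is $c\in(0,1)$ such that for all $x\in X$ and all $r\in(0,\operatorname{diam} X)$ there is $y\in X$ with $c\,r\le d(x,y)\le r$. Let $\mathscr{Q}_1,\mathscr{Q}_2,\mathscr{Q}_3\subseteq\mathscr{M}$ be the sets of all doubling, all uniformly disconnected, and all uniformly perfect spaces, respectively. For $k\in\{1,2,3\}$ put $\mathscr{E}_k(0)=\mathscr{M}\setminus\mathscr{Q}_k$, $\mathscr{E}_k(1)=\mathscr{Q}_k$ and $\mathscr{E}_k(2)=\mathscr{M}$,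 and for $(u,v,w)\in\{0,1,2\}^3$ put $$\mathscr{X}(u,v,w)=\mathscr{E}_1(u)\cap\mathscr{E}_2(v)\cap\mathscr{E}_3(w).$$ A subset of a topological space is $F_\sigma$ if it is a countable union of closed sets, $G_\delta$ if it is a countable intersection of open sets, $F_{\sigma\delta}$ if it is a countable intersection of $F_\sigma$ sets, and $G_{\delta\sigma}$ if it is a countable union of $G_\delta$ sets. **Theorem.** Let $(u,v,w)\in\{0,1,2\}^3$. Then the following hold. 1. If $\{u,v,w\}\setminus\{2\}=\{1\}$, then $\mathscr{X}(u,v,w)$ is a dense $F_\sigma$ subset of $\mathscr{M}$. 2. If $\{u,v,w\}\setminus\{2\}=\{0\}$, then $\mathscr{X}(u,v,w)$ is a dense $G_\delta$ subset of $\mathscr{M}$. 3. If $\{u,v,w\}\setminus\{2\}=\{0,1\}$, then $\mathscr{X}(u,v,w)$ is dense in $\mathscr{M}$, and it is both $F_{\sigma\delta}$ and $G_{\delta\sigma}$ in $\mathscr{M}$. -/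

import Mathlib

open GromovHausdorff

namespace GHTypes

/-- A metric space is `N`-doubling if every closed ball of radius `r > 0` is covered by at most
`N` closed balls of radius `r / 2`. -/
def IsDoublingWith (N : ℕ) (X : Type*) [MetricSpace X] : Prop :=
  ∀ x : X, ∀ r : ℝ, 0 < r → ∃ F : Finset X, F.card ≤ N ∧
    Metric.closedBall x r ⊆ ⋃ y ∈ F, Metric.closedBall y (r / 2)

/-- A metric space is doubling if it is `N`-doubling for some `N`. -/
def IsDoubling (X : Type*) [MetricSpace X] : Prop :=
  ∃ N : ℕ, IsDoublingWith N X

/-- A metric space is `δ`-uniformly disconnected if `δ * d(z₀, zₙ) ≤ maxᵢ d(zᵢ, zᵢ₊₁)` for every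
non-constant finite sequence `z₀, …, zₙ`. (Being non-constant forces `n ≥ 1`, so that the
supremum below is a maximum over a non-empty finite set.) -/
def IsUniformlyDisconnectedWith (δ : ℝ) (X : Type*) [MetricSpace X] : Prop :=
  ∀ (n : ℕ) (z : Fin (n + 1) → X), (¬ ∀ i j, z i = z j) →
    δ * dist (z 0) (z (Fin.last n)) ≤ ⨆ i : Fin n, dist (z i.castSucc) (z i.succ)

/-- A metric space is uniformly disconnected if it is `δ`-uniformly disconnected for some
`δ > 0`. -/
def IsUniformlyDisconnected (X : Type*) [MetricSpace X] : Prop :=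
  ∃ δ : ℝ, 0 < δ ∧ IsUniformlyDisconnectedWith δ X

/-- A metric space is `c`-uniformly perfect if for every point `x` and every `0 < r < diam X`
there is a point `y` with `c * r ≤ d(x, y) ≤ r`. -/
def IsUniformlyPerfectWith (c : ℝ) (X : Type*) [MetricSpace X] : Prop :=
  ∀ x : X, ∀ r : ℝ, 0 < r → ENNReal.ofReal r < Metric.ediam (Set.univ : Set X) →
    ∃ y : X, c * r ≤ dist x y ∧ dist x y ≤ r

/-- A metric space is uniformly perfect if it is `c`-uniformly perfect for some `0 < c < 1`. -/
def IsUniformlyPerfect (X : Type*) [MetricSpace X] : Prop :=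
  ∃ c : ℝ, 0 < c ∧ c < 1 ∧ IsUniformlyPerfectWith c X

/-- A set is `F_σ` if it is a countable union of closed sets. -/
def IsFsigma {X : Type*} [TopologicalSpace X] (s : Set X) : Prop :=
  ∃ f : ℕ → Set X, (∀ n, IsClosed (f n)) ∧ s = ⋃ n, f n

/-- A set is `F_{σδ}` if it is a countable intersection of `F_σ` sets. -/
def IsFsigmadelta {X : Type*} [TopologicalSpace X] (s : Set X) : Prop :=
  ∃ f : ℕ → Set X, (∀ n, IsFsigma (f n)) ∧ s = ⋂ n, f n

/-- A set is `G_{δσ}` if it is a countable union of `G_δ` sets. -/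
def IsGdeltasigma {X : Type*} [TopologicalSpace X] (s : Set X) : Prop :=
  ∃ f : ℕ → Set X, (∀ n, IsGδ (f n)) ∧ s = ⋃ n, f n

/-- The set of all doubling spaces in the Gromov–Hausdorff space. -/
def DO : Set GHSpace := {p | IsDoubling p.Rep}

/-- The set of all uniformly disconnected spaces in the Gromov–Hausdorff space. -/
def UD : Set GHSpace := {p | IsUniformlyDisconnected p.Rep}

/-- The set of all uniformly perfect spaces in the Gromov–Hausdorff space. -/
def UP : Set GHSpace := {p | IsUniformlyPerfect p.Rep}

/-- The subset prescribed by a code: `0` is the complement of `Q`, `1` is `Q`, and `2` imposes no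
condition. -/
def select (Q : Set GHSpace) (u : Fin 3) : Set GHSpace :=
  match u with
  | 0 => Qᶜ
  | 1 => Q
  | 2 => Set.univ

/-- The set of all compact metric spaces with the prescribed truth values `u`, `v`, `w` of the
doubling property, the uniform disconnectedness and the uniform perfectness. -/
def typeSet (u v w : Fin 3) : Set GHSpace :=
  select DO u ∩ select UD v ∩ select UP w

end GHTypes

/-!
A close pair of compact spaces carries a pair of maps that are adjoint up to a small error. By
compactness of the representatives, inequalities between distances pass to the limit along such
pairs, so the spaces that have one of the three properties with a fixed constant form a closed set.
Letting the constant run through a sequence shows that each property defines an `F_σ` set.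

For density, a compact space is close to the product of a finite net, a short interval and the space
of branches of a tree of small diameter. Such a product is uniformly perfect as soon as the tree
branches at almost all levels, it is doubling iff the branching is bounded, and it is uniformly
disconnected iff the interval is a point, because the space of branches is ultrametric. Adding a
single isolated point at a small distance destroys uniform perfectness and changes nothing else.
-/

namespace GHTypes

open Set Filter Topology Metric

/-! ### Approximate isometries -/

section ApproxAdjoint

variable {X Y : Type*}

/-- `f` and `g` are adjoint to each other up to an error `ε`, a quantitative form of being mutually
inverse isometries (the case `ε = 0`). Gromov–Hausdorff closeness is used only through the existence
of such pairs. -/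
def IsApproxAdjoint [PseudoMetricSpace X] [PseudoMetricSpace Y] (ε : ℝ) (f : X → Y) (g : Y → X) :
    Prop :=
  ∀ x y, |dist (f x) y - dist x (g y)| ≤ ε

theorem IsApproxAdjoint.mono [PseudoMetricSpace X] [PseudoMetricSpace Y] {ε ε' : ℝ} {f : X → Y}
    {g : Y → X} (h : IsApproxAdjoint ε f g) (hε : ε ≤ ε') : IsApproxAdjoint ε' f g :=
  fun x y ↦ (h x y).trans hε

theorem IsApproxAdjoint.abs_dist_map_sub_dist_le [PseudoMetricSpace X] [PseudoMetricSpace Y]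
    {ε : ℝ} {f : X → Y} {g : Y → X} (h : IsApproxAdjoint ε f g) (x x' : X) :
    |dist (f x) (f x') - dist x x'| ≤ 2 * ε := by
  have hgf : dist (g (f x')) x' ≤ ε := by simpa [dist_comm] using h x' (f x')
  calc |dist (f x) (f x') - dist x x'|
      ≤ |dist (f x) (f x') - dist x (g (f x'))| + |dist x (g (f x')) - dist x x'| :=
        abs_sub_le ..
    _ ≤ ε + ε := add_le_add (h x (f x')) ((dist_dist_dist_le_right ..).trans hgf)
    _ = 2 * ε := (two_mul ε).symm

variable [MetricSpace X] [CompactSpace X] [Nonempty X] [MetricSpace Y] [CompactSpace Y] [Nonempty Y]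

theorem exists_isApproxAdjoint_of_ghDist_lt {ε : ℝ} (h : ghDist X Y < ε) :
    ∃ (f : X → Y) (g : Y → X), IsApproxAdjoint (2 * ε) f g := by
  obtain ⟨Φ, Ψ, hΦ, hΨ, hd⟩ := ghDist_eq_hausdorffDist X Y
  rw [hd] at h
  have hfin : hausdorffEDist (range Φ) (range Ψ) ≠ ⊤ :=
    hausdorffEDist_ne_top_of_nonempty_of_bounded (range_nonempty _) (range_nonempty _)
      (isCompact_range hΦ.continuous).isBounded (isCompact_range hΨ.continuous).isBounded
  have hf : ∀ x, ∃ y, dist (Φ x) (Ψ y) < ε := fun x ↦ by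
    simpa using exists_dist_lt_of_hausdorffDist_lt (mem_range_self x) h hfin
  have hg : ∀ y, ∃ x, dist (Φ x) (Ψ y) < ε := fun y ↦ by
    simpa using exists_dist_lt_of_hausdorffDist_lt' (mem_range_self y) h hfin
  choose f hf using hf
  choose g hg using hg
  refine ⟨f, g, fun x y ↦ ?_⟩
  calc |dist (f x) y - dist x (g y)|
      = dist (dist (Ψ (f x)) (Ψ y)) (dist (Φ x) (Φ (g y))) := by
        rw [hΨ.dist_eq, hΦ.dist_eq, Real.dist_eq]
    _ ≤ dist (Ψ (f x)) (Φ x) + dist (Ψ y) (Φ (g y)) := dist_dist_dist_le ..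
    _ ≤ ε + ε := by
        rw [dist_comm (Ψ (f x)), dist_comm (Ψ y)]
        exact add_le_add (hf x).le (hg y).le
    _ = 2 * ε := (two_mul ε).symm

end ApproxAdjoint

theorem isClosed_of_forall_isApproxAdjoint {S : Set GHSpace}
    (h : ∀ p : GHSpace, (∀ ε > 0, ∃ q ∈ S, ∃ (f : p.Rep → q.Rep) (g : q.Rep → p.Rep),
      IsApproxAdjoint ε f g) → p ∈ S) : IsClosed S := by
  refine isClosed_of_closure_subset fun p hp ↦ h p fun ε hε ↦ ?_
  obtain ⟨q, hq, hpq⟩ := Metric.mem_closure_iff.1 hp (ε / 2) (half_pos hε)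
  rw [dist_ghDist] at hpq
  obtain ⟨f, g, hfg⟩ := exists_isApproxAdjoint_of_ghDist_lt hpq
  exact ⟨q, hq, f, g, hfg.mono (mul_div_cancel₀ _ two_ne_zero).le⟩

theorem exists_mem_of_forall_gt_of_isClosed {α Y : Type*} [LinearOrder α] [TopologicalSpace α]
    [OrderTopology α] [DenselyOrdered α] [NoMaxOrder α] [TopologicalSpace Y] [CompactSpace Y]
    {S : Set (α × Y)} (hS : IsClosed S) {a : α} (h : ∀ t > a, ∃ y, (t, y) ∈ S) :
    ∃ y, (a, y) ∈ S := by
  have hclosed : IsClosed (Prod.fst '' S) := isClosedMap_fst_of_compactSpace S hS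
  have hsub : Ioi a ⊆ Prod.fst '' S := fun t ht ↦ by simpa using h t ht
  have ha : a ∈ closure (Ioi a) := by simp
  simpa using closure_minimal hsub hclosed ha

section Product

variable {X Y : Type*} [PseudoMetricSpace X] [PseudoMetricSpace Y]

theorem isometry_prodMk_right (x : X) : Isometry fun y : Y ↦ (x, y) :=
  Isometry.of_dist_eq fun y y' ↦ by simp [Prod.dist_eq]

theorem isometry_prodMk_left (y : Y) : Isometry fun x : X ↦ (x, y) :=
  Isometry.of_dist_eq fun x x' ↦ by simp [Prod.dist_eq]

end Product

/-! ### Doubling spaces -/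

section Doubling

variable {X Y : Type*} [MetricSpace X] [MetricSpace Y]

theorem isDoublingWith_iff {N : ℕ} :
    IsDoublingWith N X ↔ ∀ x : X, ∀ r : ℝ, 0 < r →
      ∃ c : Fin N → X, closedBall x r ⊆ ⋃ i, closedBall (c i) (r / 2) := by
  classical
  refine forall_congr' fun x ↦ forall₂_congr fun r _ ↦ ⟨?_, ?_⟩
  · rintro ⟨F, hF, hcov⟩
    refine ⟨fun i ↦ if h : i.1 < F.card then F.equivFin.symm ⟨i, h⟩ else x, fun z hz ↦ ?_⟩
    obtain ⟨y, hy, hzy⟩ := mem_iUnion₂.1 (hcov hz)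
    refine mem_iUnion.2 ⟨⟨F.equivFin ⟨y, hy⟩, (F.equivFin ⟨y, hy⟩).2.trans_le hF⟩, ?_⟩
    simpa using hzy
  · rintro ⟨c, hc⟩
    exact ⟨Finset.univ.image c, Finset.card_image_le.trans (by simp), by simpa using hc⟩

theorem isDoubling_of_exists_cover {ι : Type*} [Finite ι]
    (h : ∀ x : X, ∀ r : ℝ, 0 < r → ∃ c : ι → X, closedBall x r ⊆ ⋃ i, closedBall (c i) (r / 2)) :
    IsDoubling X := by
  refine ⟨Nat.card ι, isDoublingWith_iff.2 fun x r hr ↦ ?_⟩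
  obtain ⟨c, hc⟩ := h x r hr
  refine ⟨c ∘ (Finite.equivFin ι).symm, hc.trans_eq ?_⟩
  exact ((Finite.equivFin ι).symm.surjective.iUnion_comp fun i ↦ closedBall (c i) (r / 2)).symm

theorem isClosed_setOf_isDoublingWith (N : ℕ) :
    IsClosed {p : GHSpace | IsDoublingWith N p.Rep} := by
  refine isClosed_of_forall_isApproxAdjoint fun p hp ↦ isDoublingWith_iff.2 fun x r hr ↦ ?_
  let S : Set (ℝ × (Fin N → p.Rep)) :=
    {s | ∀ z ∈ closedBall x r, ∃ i, dist z (s.2 i) ≤ r / 2 + s.1}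
  have hS : IsClosed S := by
    simp only [S, ofPred_forall, ofPred_exists]
    exact isClosed_biInter fun z _ ↦ isClosed_iUnion_of_finite fun i ↦
      isClosed_le (by fun_prop) (by fun_prop)
  obtain ⟨c, hc⟩ : ∃ c, (0, c) ∈ S := by
    refine exists_mem_of_forall_gt_of_isClosed hS fun ε hε ↦ ?_
    obtain ⟨q, hq, f, g, hfg⟩ := hp (ε / 2) (half_pos hε)
    obtain ⟨c, hc⟩ := isDoublingWith_iff.1 hq (f x) (r + ε) (by positivity)
    refine ⟨g ∘ c, fun z hz ↦ ?_⟩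
    have hfz : f z ∈ closedBall (f x) (r + ε) := by
      have := (abs_sub_le_iff.1 (hfg.abs_dist_map_sub_dist_le z x)).1
      rw [mem_closedBall] at hz ⊢
      linarith
    obtain ⟨i, hi⟩ := mem_iUnion.1 (hc hfz)
    rw [mem_closedBall] at hi
    have : dist z (g (c i)) ≤ r / 2 + ε := by linarith [(abs_sub_le_iff.1 (hfg z (c i))).2]
    exact ⟨i, this⟩
  refine ⟨c, fun z hz ↦ mem_iUnion.2 ?_⟩
  simpa [S] using hc z hz

theorem exists_preimage_iUnion_closedBall_subset [Nonempty X] {f : X → Y} (hf : Isometry f)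
    {ι : Type*} (c : ι → Y) (r : ℝ) :
    ∃ d : ι → X, f ⁻¹' (⋃ i, closedBall (c i) r) ⊆ ⋃ i, closedBall (d i) (2 * r) := by
  have hd : ∀ i, ∃ d : X, ∀ z, dist (f z) (c i) ≤ r → dist z d ≤ 2 * r := fun i ↦ by
    by_cases hne : ∃ d, dist (f d) (c i) ≤ r
    · obtain ⟨d, hd⟩ := hne
      refine ⟨d, fun z hz ↦ ?_⟩
      rw [← hf.dist_eq]
      linarith [dist_triangle_right (f z) (f d) (c i)]
    · exact ⟨Classical.arbitrary X, fun z hz ↦ absurd ⟨z, hz⟩ hne⟩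
  choose d hd using hd
  refine ⟨d, fun z hz ↦ ?_⟩
  obtain ⟨i, hi⟩ := mem_iUnion.1 hz
  exact mem_iUnion.2 ⟨i, hd i z hi⟩

theorem IsDoubling.of_isometry {f : X → Y} (hY : IsDoubling Y) (hf : Isometry f) :
    IsDoubling X := by
  obtain ⟨N, hN⟩ := hY
  rw [isDoublingWith_iff] at hN
  refine isDoubling_of_exists_cover (ι := Fin N × Fin N) fun x r hr ↦ ?_
  obtain ⟨c, hc⟩ := hN (f x) r hr
  choose d hd using fun i ↦ hN (c i) (r / 2) (half_pos hr)
  have : Nonempty X := ⟨x⟩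
  obtain ⟨e, he⟩ :=
    exists_preimage_iUnion_closedBall_subset hf (fun i : Fin N × Fin N ↦ d i.1 i.2) (r / 2 / 2)
  rw [mul_div_cancel₀ _ two_ne_zero] at he
  refine ⟨e, fun z hz ↦ he ?_⟩
  obtain ⟨i, hi⟩ := mem_iUnion.1 (hc ((hf.mapsTo_closedBall x r) hz))
  obtain ⟨j, hj⟩ := mem_iUnion.1 (hd i hi)
  exact mem_iUnion.2 ⟨(i, j), hj⟩

theorem isDoubling_congr (e : X ≃ᵢ Y) : IsDoubling X ↔ IsDoubling Y :=
  ⟨fun h ↦ h.of_isometry e.symm.isometry, fun h ↦ h.of_isometry e.isometry⟩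

theorem IsDoubling.prod (hX : IsDoubling X) (hY : IsDoubling Y) : IsDoubling (X × Y) := by
  obtain ⟨M, hM⟩ := hX
  obtain ⟨N, hN⟩ := hY
  refine isDoubling_of_exists_cover (ι := Fin M × Fin N) fun x r hr ↦ ?_
  obtain ⟨c, hc⟩ := isDoublingWith_iff.1 hM x.1 r hr
  obtain ⟨d, hd⟩ := isDoublingWith_iff.1 hN x.2 r hr
  refine ⟨fun i ↦ (c i.1, d i.2), ?_⟩
  calc closedBall x r = closedBall x.1 r ×ˢ closedBall x.2 r := (closedBall_prod_same ..).symm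
    _ ⊆ (⋃ i, closedBall (c i) (r / 2)) ×ˢ ⋃ j, closedBall (d j) (r / 2) := prod_mono hc hd
    _ = ⋃ i : Fin M × Fin N, closedBall (c i.1, d i.2) (r / 2) := by
      simp only [← closedBall_prod_same]
      exact (iUnion_prod ..).symm

theorem isDoubling_prod_iff [Nonempty X] [Nonempty Y] :
    IsDoubling (X × Y) ↔ IsDoubling X ∧ IsDoubling Y :=
  ⟨fun h ↦ ⟨h.of_isometry (isometry_prodMk_left (Classical.arbitrary Y)),
    h.of_isometry (isometry_prodMk_right (Classical.arbitrary X))⟩, fun h ↦ h.1.prod h.2⟩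

theorem isDoubling_of_finite [Finite X] : IsDoubling X :=
  isDoubling_of_exists_cover (ι := X) fun _ _ hr ↦
    ⟨id, fun z _ ↦ mem_iUnion.2 ⟨z, mem_closedBall_self (half_pos hr).le⟩⟩

theorem isDoubling_real : IsDoubling ℝ := by
  refine isDoubling_of_exists_cover (ι := Bool) fun x r _ ↦
    ⟨fun i ↦ if i then x + r / 2 else x - r / 2, fun z hz ↦ mem_iUnion.2 ?_⟩
  simp only [Bool.exists_bool, Real.closedBall_eq_Icc, mem_Icc] at hz ⊢
  rcases le_total z x with h | h
  · left
    constructor <;> simp <;> linarith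
  · right
    constructor <;> simp <;> linarith

end Doubling

/-! ### Uniformly disconnected spaces -/

section UniformlyDisconnected

/-- The points `x` and `y` are the ends of a finite chain whose steps have length at most `M`. -/
def JoinedByChain {X : Type*} [Dist X] (M : ℝ) : X → X → Prop :=
  Relation.ReflTransGen fun a b ↦ dist a b ≤ M

theorem JoinedByChain.map {X Y : Type*} [Dist X] [Dist Y] {M M' : ℝ} {x y : X}
    (h : JoinedByChain M x y) {f : X → Y} (hf : ∀ a b, dist a b ≤ M → dist (f a) (f b) ≤ M') :
    JoinedByChain M' (f x) (f y) :=
  Relation.ReflTransGen.lift f hf _ _ h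

theorem joinedByChain_of_fin {X : Type*} [Dist X] {M : ℝ} {n : ℕ} {z : Fin (n + 1) → X}
    (hz : ∀ i : Fin n, dist (z i.castSucc) (z i.succ) ≤ M) (i : Fin (n + 1)) :
    JoinedByChain M (z 0) (z i) :=
  Fin.induction .refl (fun i ih ↦ ih.tail (hz i)) i

theorem JoinedByChain.exists_fin {X : Type*} [Dist X] {M : ℝ} {x y : X}
    (h : JoinedByChain M x y) : ∃ (n : ℕ) (z : Fin (n + 1) → X),
      z 0 = x ∧ z (Fin.last n) = y ∧ ∀ i : Fin n, dist (z i.castSucc) (z i.succ) ≤ M := by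
  suffices ∃ p : RelSeries {(a, b) : X × X | dist a b ≤ M}, p.head = x ∧ p.last = y by
    obtain ⟨p, hx, hy⟩ := this
    exact ⟨p.length, p, hx, hy, p.step⟩
  induction h with
  | refl => exact ⟨.singleton _ x, rfl, rfl⟩
  | tail _ hstep ih =>
    obtain ⟨p, hx, rfl⟩ := ih
    exact ⟨p.snoc _ hstep, by simpa using hx, by simp⟩

theorem joinedByChain_of_preconnectedSpace {X : Type*} [PseudoMetricSpace X] [PreconnectedSpace X]
    {M : ℝ} (hM : 0 < M) (x y : X) : JoinedByChain M x y := by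
  refine PreconnectedSpace.induction₂' (JoinedByChain M) (fun x ↦ ?_) ⟨fun _ _ _ ↦ .trans⟩ x y
  filter_upwards [closedBall_mem_nhds x hM] with y hy
  exact ⟨.single (mem_closedBall'.1 hy), .single (mem_closedBall.1 hy)⟩

theorem JoinedByChain.dist_le {X : Type*} [PseudoMetricSpace X] [IsUltrametricDist X] {M : ℝ}
    (hM : 0 ≤ M) {x y : X} (h : JoinedByChain M x y) : dist x y ≤ M := by
  induction h with
  | refl => rwa [dist_self]
  | tail _ hstep ih => exact (dist_triangle_max ..).trans (max_le ih hstep)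

theorem JoinedByChain.eq_of_lt {X : Type*} [Dist X] {M s : ℝ} {x y : X} (h : JoinedByChain M x y)
    (hs : Pairwise fun a b : X ↦ s ≤ dist a b) (hM : M < s) : x = y := by
  induction h with
  | refl => rfl
  | tail _ hstep ih => exact ih.trans (hs.eq (hstep.trans_lt hM).not_ge)

variable {X Y : Type*} [MetricSpace X] [MetricSpace Y]

theorem isUniformlyDisconnectedWith_iff {δ : ℝ} :
    IsUniformlyDisconnectedWith δ X ↔
      ∀ M ≥ 0, ∀ x y : X, JoinedByChain M x y → δ * dist x y ≤ M := by
  constructor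
  · intro h M hM x y hxy
    obtain ⟨n, z, rfl, rfl, hz⟩ := hxy.exists_fin
    by_cases hconst : ∀ i j, z i = z j
    · rwa [hconst 0 (Fin.last n), dist_self, mul_zero]
    · exact (h n z hconst).trans (Real.iSup_le hz hM)
  · intro h n z _
    refine h _ (Real.iSup_nonneg fun _ ↦ dist_nonneg) _ _ (joinedByChain_of_fin (fun i ↦ ?_) _)
    exact le_ciSup (f := fun i : Fin n ↦ dist (z i.castSucc) (z i.succ))
      (finite_range _).bddAbove i

theorem IsUniformlyDisconnectedWith.anti {δ δ' : ℝ} (h : IsUniformlyDisconnectedWith δ X)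
    (hδ : δ' ≤ δ) : IsUniformlyDisconnectedWith δ' X :=
  fun n z hz ↦ (mul_le_mul_of_nonneg_right hδ dist_nonneg).trans (h n z hz)

theorem isClosed_setOf_isUniformlyDisconnectedWith {δ : ℝ} (hδ : 0 ≤ δ) :
    IsClosed {p : GHSpace | IsUniformlyDisconnectedWith δ p.Rep} := by
  refine isClosed_of_forall_isApproxAdjoint fun p hp ↦
    isUniformlyDisconnectedWith_iff.2 fun M hM x y hxy ↦ le_of_forall_pos_le_add fun η hη ↦ ?_
  let ε := η / (2 * (1 + δ))
  have hε : 0 < ε := by positivity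
  obtain ⟨q, hq, f, g, hfg⟩ := hp ε hε
  have hdist (a b : p.Rep) := abs_sub_le_iff.1 (hfg.abs_dist_map_sub_dist_le a b)
  have hchain : JoinedByChain (M + 2 * ε) (f x) (f y) :=
    hxy.map fun a b hab ↦ by linarith [(hdist a b).1]
  calc δ * dist x y ≤ δ * (dist (f x) (f y) + 2 * ε) := by gcongr; linarith [(hdist x y).2]
    _ = δ * dist (f x) (f y) + δ * (2 * ε) := mul_add ..
    _ ≤ M + 2 * ε + δ * (2 * ε) := by
      gcongr
      exact isUniformlyDisconnectedWith_iff.1 hq _ (by positivity) _ _ hchain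
    _ = M + η := by simp only [ε]; field_simp; ring

theorem IsUniformlyDisconnected.of_isometry {f : X → Y} (hY : IsUniformlyDisconnected Y)
    (hf : Isometry f) : IsUniformlyDisconnected X := by
  obtain ⟨δ, hδ, h⟩ := hY
  refine ⟨δ, hδ, isUniformlyDisconnectedWith_iff.2 fun M hM x y hxy ↦ ?_⟩
  rw [← hf.dist_eq]
  exact isUniformlyDisconnectedWith_iff.1 h M hM _ _
    (hxy.map fun a b hab ↦ (hf.dist_eq a b).trans_le hab)

theorem isUniformlyDisconnected_congr (e : X ≃ᵢ Y) :
    IsUniformlyDisconnected X ↔ IsUniformlyDisconnected Y :=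
  ⟨fun h ↦ h.of_isometry e.symm.isometry, fun h ↦ h.of_isometry e.isometry⟩

theorem IsUniformlyDisconnected.prod (hX : IsUniformlyDisconnected X)
    (hY : IsUniformlyDisconnected Y) : IsUniformlyDisconnected (X × Y) := by
  obtain ⟨δ, hδ, h⟩ := hX
  obtain ⟨δ', hδ', h'⟩ := hY
  have hmin : 0 < min δ δ' := lt_min hδ hδ'
  refine ⟨min δ δ', hmin, isUniformlyDisconnectedWith_iff.2 fun M hM x y hxy ↦ ?_⟩
  rw [Prod.dist_eq, mul_max_of_nonneg _ _ hmin.le]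
  exact max_le
    (isUniformlyDisconnectedWith_iff.1 (h.anti (min_le_left ..)) M hM _ _
      (hxy.map fun _ _ hab ↦ (le_max_left ..).trans hab))
    (isUniformlyDisconnectedWith_iff.1 (h'.anti (min_le_right ..)) M hM _ _
      (hxy.map fun _ _ hab ↦ (le_max_right ..).trans hab))

theorem isUniformlyDisconnected_prod_iff [Nonempty X] [Nonempty Y] :
    IsUniformlyDisconnected (X × Y) ↔ IsUniformlyDisconnected X ∧ IsUniformlyDisconnected Y :=
  ⟨fun h ↦ ⟨h.of_isometry (isometry_prodMk_left (Classical.arbitrary Y)),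
    h.of_isometry (isometry_prodMk_right (Classical.arbitrary X))⟩, fun h ↦ h.1.prod h.2⟩

theorem isUniformlyDisconnected_of_isUltrametricDist [IsUltrametricDist X] :
    IsUniformlyDisconnected X :=
  ⟨1, one_pos, isUniformlyDisconnectedWith_iff.2 fun M hM x y hxy ↦ by
    simpa using hxy.dist_le hM⟩

theorem isUniformlyDisconnected_of_separated [BoundedSpace X] {s : ℝ} (hs : 0 < s)
    (hsep : Pairwise fun x y : X ↦ s ≤ dist x y) : IsUniformlyDisconnected X := by
  have hD : 0 < diam (univ : Set X) + 1 := by positivity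
  refine ⟨s / (diam (univ : Set X) + 1), by positivity,
    isUniformlyDisconnectedWith_iff.2 fun M hM x y hxy ↦ ?_⟩
  rcases lt_or_ge M s with hMs | hMs
  · rwa [hxy.eq_of_lt hsep hMs, dist_self, mul_zero]
  · have hdist : dist x y ≤ diam (univ : Set X) :=
      dist_le_diam_of_mem (Bornology.isBounded_univ.2 ‹_›) (mem_univ x) (mem_univ y)
    calc s / (diam (univ : Set X) + 1) * dist x y
        ≤ s / (diam (univ : Set X) + 1) * (diam (univ : Set X) + 1) := by gcongr; linarith
      _ = s := div_mul_cancel₀ _ hD.ne'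
      _ ≤ M := hMs

theorem isUniformlyDisconnected_of_finite [Finite X] : IsUniformlyDisconnected X := by
  rcases subsingleton_or_nontrivial X with _ | _
  · exact isUniformlyDisconnected_of_separated one_pos Subsingleton.pairwise
  · have hsep : 0 < infsep (univ : Set X) := infsep_pos_iff_nontrivial_of_finite.2 nontrivial_univ
    exact isUniformlyDisconnected_of_separated hsep fun x y hxy ↦
      infsep_le_dist_of_mem (mem_univ x) (mem_univ y) hxy

theorem IsUniformlyDisconnected.subsingleton [PreconnectedSpace X]
    (h : IsUniformlyDisconnected X) : Subsingleton X := by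
  obtain ⟨δ, hδ, h⟩ := h
  refine ⟨fun x y ↦ ?_⟩
  have hle : δ * dist x y ≤ 0 := le_of_forall_gt_imp_ge_of_dense fun M hM ↦
    isUniformlyDisconnectedWith_iff.1 h M hM.le x y (joinedByChain_of_preconnectedSpace hM x y)
  exact dist_le_zero.1 (nonpos_of_mul_nonpos_right hle hδ)

end UniformlyDisconnected

/-! ### Uniformly perfect spaces -/

section UniformlyPerfect

theorem ofReal_lt_ediam_univ_iff {X : Type*} [PseudoMetricSpace X] {r : ℝ} (hr : 0 ≤ r) :
    ENNReal.ofReal r < ediam (univ : Set X) ↔ ∃ a b : X, r < dist a b := by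
  rw [← not_iff_not]
  simp [ediam_le_iff, edist_dist, ENNReal.ofReal_le_ofReal_iff hr]

variable {X Y : Type*} [MetricSpace X] [MetricSpace Y]

theorem isUniformlyPerfectWith_iff {c : ℝ} :
    IsUniformlyPerfectWith c X ↔ ∀ x a b : X, ∀ r : ℝ, 0 < r → r < dist a b →
      ∃ y, c * r ≤ dist x y ∧ dist x y ≤ r :=
  ⟨fun h x a b r hr hab ↦ h x r hr ((ofReal_lt_ediam_univ_iff hr.le).2 ⟨a, b, hab⟩),
    fun h x r hr hdiam ↦
      have ⟨a, b, hab⟩ := (ofReal_lt_ediam_univ_iff hr.le).1 hdiam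
      h x a b r hr hab⟩

theorem IsUniformlyPerfectWith.anti {c c' : ℝ} (h : IsUniformlyPerfectWith c X) (hc : c' ≤ c) :
    IsUniformlyPerfectWith c' X := fun x r hr hdiam ↦ by
  obtain ⟨y, hcy, hy⟩ := h x r hr hdiam
  exact ⟨y, (mul_le_mul_of_nonneg_right hc hr.le).trans hcy, hy⟩

theorem isUniformlyPerfect_iff : IsUniformlyPerfect X ↔ ∃ c > 0, IsUniformlyPerfectWith c X :=
  ⟨fun ⟨c, hc, _, h⟩ ↦ ⟨c, hc, h⟩, fun ⟨c, hc, h⟩ ↦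
    ⟨min c (1 / 2), by positivity, by norm_num, h.anti (min_le_left ..)⟩⟩

theorem isClosed_setOf_isUniformlyPerfectWith (c : ℝ) :
    IsClosed {p : GHSpace | IsUniformlyPerfectWith c p.Rep} := by
  refine isClosed_of_forall_isApproxAdjoint fun p hp ↦
    isUniformlyPerfectWith_iff.2 fun x a b r hr hab ↦ ?_
  let S : Set (ℝ × p.Rep) := {s | c * r - s.1 ≤ dist x s.2 ∧ dist x s.2 ≤ r + s.1}
  have hlower : IsClosed {s : ℝ × p.Rep | c * r - s.1 ≤ dist x s.2} :=
    isClosed_le (by fun_prop) (by fun_prop)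
  have hupper : IsClosed {s : ℝ × p.Rep | dist x s.2 ≤ r + s.1} :=
    isClosed_le (by fun_prop) (by fun_prop)
  have hS : IsClosed S := hlower.inter hupper
  suffices ∃ y, (0, y) ∈ S by simpa [S] using this
  refine exists_mem_of_forall_gt_of_isClosed hS fun ε hε ↦ ?_
  obtain ⟨q, hq, f, g, hfg⟩ := hp (min ε ((dist a b - r) / 3)) (lt_min hε (by linarith))
  have hfab : r < dist (f a) (f b) := by
    linarith [(abs_sub_le_iff.1 (hfg.abs_dist_map_sub_dist_le a b)).2,
      min_le_right ε ((dist a b - r) / 3)]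
  obtain ⟨y, hcy, hy⟩ := isUniformlyPerfectWith_iff.1 hq (f x) (f a) (f b) r hr hfab
  have hgy := abs_sub_le_iff.1 ((hfg.mono (min_le_left ..)) x y)
  have hlower : c * r - ε ≤ dist x (g y) := by linarith
  have hupper : dist x (g y) ≤ r + ε := by linarith
  exact ⟨g y, hlower, hupper⟩

theorem IsUniformlyPerfect.of_isometryEquiv (hY : IsUniformlyPerfect Y) (e : X ≃ᵢ Y) :
    IsUniformlyPerfect X := by
  obtain ⟨c, hc, hc1, h⟩ := hY
  refine ⟨c, hc, hc1, fun x r hr hdiam ↦ ?_⟩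
  obtain ⟨y, hy⟩ := h (e x) r hr (by rwa [← e.ediam_univ])
  exact ⟨e.symm y, by rwa [← e.dist_eq, e.apply_symm_apply]⟩

theorem isUniformlyPerfect_congr (e : X ≃ᵢ Y) : IsUniformlyPerfect X ↔ IsUniformlyPerfect Y :=
  ⟨fun h ↦ h.of_isometryEquiv e.symm, fun h ↦ h.of_isometryEquiv e⟩

theorem isUniformlyPerfect_of_forall_lt [BoundedSpace X] {c R : ℝ} (hc : 0 < c) (hR : 0 < R)
    (h : ∀ x : X, ∀ r, 0 < r → r < R → ∃ y, c * r ≤ dist x y ∧ dist x y ≤ r) :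
    IsUniformlyPerfect X := by
  set D := diam (univ : Set X)
  have hD : 0 ≤ D := diam_nonneg
  -- Shrinking radii by the factor `R / (R + D)` brings every `r < D` below `R`.
  refine isUniformlyPerfect_iff.2 ⟨c * (R / (R + D)), by positivity,
    isUniformlyPerfectWith_iff.2 fun x a b r hr hab ↦ ?_⟩
  have hrD : r < R + D := by
    linarith [dist_le_diam_of_mem (Bornology.isBounded_univ.2 ‹_›) (mem_univ a) (mem_univ b)]
  have hsmall : R / (R + D) * r < R := by
    rw [div_mul_eq_mul_div, div_lt_iff₀ (by positivity)]
    gcongr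
  have hle : R / (R + D) * r ≤ r :=
    mul_le_of_le_one_left hr.le ((div_le_one (by positivity)).2 (le_add_of_nonneg_right hD))
  obtain ⟨y, hcy, hy⟩ := h x _ (by positivity) hsmall
  exact ⟨y, by rwa [mul_assoc], hy.trans hle⟩

theorem IsUniformlyPerfect.prod [BoundedSpace X] [BoundedSpace Y] [Nontrivial Y]
    (hY : IsUniformlyPerfect Y) : IsUniformlyPerfect (X × Y) := by
  obtain ⟨c, hc, -, h⟩ := hY
  obtain ⟨a, b, hab⟩ := exists_pair_ne Y
  refine isUniformlyPerfect_of_forall_lt hc (dist_pos.2 hab) fun x r hr hrab ↦ ?_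
  obtain ⟨y, hy⟩ := isUniformlyPerfectWith_iff.1 h x.2 a b r hr hrab
  refine ⟨(x.1, y), ?_⟩
  rwa [Prod.dist_eq, dist_self, max_eq_right dist_nonneg]

theorem IsUniformlyPerfect.not_isOpen_singleton [Nontrivial X] (h : IsUniformlyPerfect X) (x : X) :
    ¬ IsOpen {x} := by
  intro hx
  obtain ⟨c, hc, -, h⟩ := h
  obtain ⟨ρ, hρ, hisolated⟩ := Metric.isOpen_singleton_iff.1 hx
  obtain ⟨x', hne⟩ := exists_ne x
  obtain ⟨r, hr, hrmin⟩ := exists_between (lt_min hρ (dist_pos.2 hne))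
  obtain ⟨hrρ, hrx'⟩ := lt_min_iff.1 hrmin
  obtain ⟨y, hcy, hy⟩ := isUniformlyPerfectWith_iff.1 h x x' x r hr hrx'
  have hyx : y = x := hisolated y (by rw [dist_comm]; exact hy.trans_lt hrρ)
  rw [hyx, dist_self] at hcy
  exact hcy.not_gt (mul_pos hc hr)

end UniformlyPerfect

/-! ### Rooted trees with prescribed branching -/

/-- The space of infinite branches of the rooted tree in which every node at level `n` has `b n + 1`
children, with the distance `2 ^ (-n)` between branches that separate at level `n`. -/
def Tree (b : ℕ → ℕ) : Type := ∀ n, Fin (b n + 1)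

namespace Tree

variable {b : ℕ → ℕ}

noncomputable instance : MetricSpace (Tree b) := PiNat.metricSpace (E := fun n ↦ Fin (b n + 1))

instance : CompactSpace (Tree b) := inferInstanceAs (CompactSpace (∀ n, Fin (b n + 1)))

instance : IsUltrametricDist (Tree b) := ⟨PiNat.dist_triangle_nonarch⟩

instance : Inhabited (Tree b) := inferInstanceAs (Inhabited (∀ n, Fin (b n + 1)))

theorem dist_le_pow_iff {x y : Tree b} {n : ℕ} : dist x y ≤ (1 / 2) ^ n ↔ ∀ i < n, x i = y i :=
  PiNat.mem_cylinder_iff_dist_le.symm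

theorem pow_le_dist {x y : Tree b} {n : ℕ} (h : x n ≠ y n) : (1 / 2) ^ n ≤ dist x y :=
  le_of_not_gt fun hlt ↦ h (PiNat.apply_eq_of_dist_lt hlt le_rfl)

/-- The branch that agrees with `x` except possibly at level `n`, where it takes the child `j`. -/
def update (x : Tree b) (n : ℕ) (j : Fin (b n + 1)) : Tree b := Function.update x n j

theorem update_self (x : Tree b) (n : ℕ) (j : Fin (b n + 1)) : x.update n j n = j :=
  Function.update_self ..

theorem update_of_ne (x : Tree b) {n i : ℕ} (h : i ≠ n) (j : Fin (b n + 1)) :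
    x.update n j i = x i :=
  Function.update_of_ne h ..

theorem dist_update_le (x : Tree b) (n : ℕ) (j : Fin (b n + 1)) :
    dist x (x.update n j) ≤ (1 / 2) ^ n :=
  dist_le_pow_iff.2 fun _ hi ↦ (update_of_ne x hi.ne j).symm

theorem dist_update_le_of_dist_lt {x z : Tree b} {n : ℕ} (h : ∀ k < n, dist z x < (1 / 2) ^ k) :
    dist z (x.update n (z n)) ≤ (1 / 2) ^ (n + 1) := by
  refine dist_le_pow_iff.2 fun i hi ↦ ?_
  rcases Nat.lt_succ_iff_lt_or_eq.1 hi with hin | rfl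
  · exact (PiNat.apply_eq_of_dist_lt (h i hin) le_rfl).trans (update_of_ne x hin.ne _).symm
  · exact (update_self x i (z i)).symm

theorem isDoubling_of_bddAbove (hb : BddAbove (range b)) : IsDoubling (Tree b) := by
  obtain ⟨B, hB⟩ := hb
  refine isDoubling_of_exists_cover (ι := Fin (B + 1)) fun x r hr ↦ ?_
  have hex : ∃ n : ℕ, (1 / 2 : ℝ) ^ n ≤ r :=
    (exists_pow_lt_of_lt_one hr one_half_lt_one).imp fun _ ↦ le_of_lt
  classical
  let n := Nat.find hex
  have hnr : (1 / 2 : ℝ) ^ n ≤ r := Nat.find_spec hex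
  have hrn (k : ℕ) (hk : k < n) : r < (1 / 2 : ℝ) ^ k := not_le.1 (Nat.find_min hex hk)
  refine ⟨fun i ↦ x.update n (Fin.ofNat _ i), fun z hz ↦ mem_iUnion.2 ?_⟩
  have hzn : (z n : ℕ) < B + 1 := (z n).2.trans_le (Nat.succ_le_succ (hB (mem_range_self n)))
  refine ⟨⟨z n, hzn⟩, ?_⟩
  calc dist z (x.update n (Fin.ofNat _ (z n))) = dist z (x.update n (z n)) := by
        rw [Fin.ofNat_val_eq_self]
    _ ≤ (1 / 2) ^ (n + 1) :=
        dist_update_le_of_dist_lt fun k hk ↦ (mem_closedBall.1 hz).trans_lt (hrn k hk)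
    _ = (1 / 2) ^ n / 2 := by rw [pow_succ, mul_one_div]
    _ ≤ r / 2 := by gcongr

theorem bddAbove_of_isDoubling (h : IsDoubling (Tree b)) : BddAbove (range b) := by
  obtain ⟨N, hN⟩ := h
  refine ⟨N, forall_mem_range.2 fun n ↦ ?_⟩
  obtain ⟨c, hc⟩ := isDoublingWith_iff.1 hN default ((1 / 2) ^ n) (by positivity)
  have hball (j) : (default : Tree b).update n j ∈ closedBall default ((1 / 2) ^ n) :=
    mem_closedBall'.2 (dist_update_le ..)
  choose k hk using fun j ↦ mem_iUnion.1 (hc (hball j))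
  have hk_injective : Function.Injective k := fun j j' hjj' ↦ by
    by_contra hne
    have hsmall : dist ((default : Tree b).update n j) ((default : Tree b).update n j') ≤
        (1 / 2) ^ n / 2 :=
      (dist_triangle_max _ (c (k j)) _).trans
        (max_le (hk j) (by rw [hjj']; exact mem_closedBall'.1 (hk j')))
    have hlarge : (1 / 2 : ℝ) ^ n ≤
        dist ((default : Tree b).update n j) ((default : Tree b).update n j') :=
      pow_le_dist (by rwa [update_self, update_self])
    exact (hlarge.trans hsmall).not_gt (half_lt_self (by positivity))
  have hcard : b n + 1 ≤ N := by simpa using Fintype.card_le_of_injective k hk_injective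
  exact (Nat.le_succ _).trans hcard

theorem isDoubling_iff : IsDoubling (Tree b) ↔ BddAbove (range b) :=
  ⟨bddAbove_of_isDoubling, isDoubling_of_bddAbove⟩

theorem exists_dist_mem_Icc {m : ℕ} (hb : ∀ n ≥ m, b n ≠ 0) (x : Tree b) {r : ℝ} (hr : 0 < r)
    (hrm : r < (1 / 2) ^ m) : ∃ y, 1 / 2 * r ≤ dist x y ∧ dist x y ≤ r := by
  obtain ⟨n, hnr, hrn⟩ := exists_nat_pow_near_of_lt_one hr
    (hrm.le.trans (pow_le_one₀ (by norm_num) (by norm_num))) one_half_pos one_half_lt_one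
  have hmn : m < n + 1 := (pow_lt_pow_iff_right_of_lt_one₀ one_half_pos one_half_lt_one).1
    (hnr.trans hrm)
  have : NeZero (b (n + 1)) := ⟨hb _ hmn.le⟩
  obtain ⟨j, hj⟩ := exists_ne (x (n + 1))
  refine ⟨x.update (n + 1) j, ?_, (dist_update_le ..).trans hnr.le⟩
  calc 1 / 2 * r ≤ 1 / 2 * (1 / 2) ^ n := by gcongr
    _ = (1 / 2) ^ (n + 1) := (pow_succ' ..).symm
    _ ≤ dist x (x.update (n + 1) j) := pow_le_dist (by rwa [update_self, ne_comm])

theorem isUniformlyPerfect (hb : ∀ᶠ n in atTop, b n ≠ 0) : IsUniformlyPerfect (Tree b) :=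
  have ⟨m, hm⟩ := eventually_atTop.1 hb
  isUniformlyPerfect_of_forall_lt one_half_pos (R := (1 / 2) ^ m) (by positivity)
    fun x _ hr hrm ↦ exists_dist_mem_Icc hm x hr hrm

theorem nontrivial {n : ℕ} (hn : b n ≠ 0) : Nontrivial (Tree b) := by
  have : NeZero (b n) := ⟨hn⟩
  obtain ⟨j, hj⟩ := exists_ne ((default : Tree b) n)
  exact ⟨default, (default : Tree b).update n j, fun h ↦ hj (by rw [h, update_self])⟩

theorem dist_le_pow {m : ℕ} (hb : ∀ n < m, b n = 0) (x y : Tree b) :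
    dist x y ≤ (1 / 2) ^ m :=
  dist_le_pow_iff.2 fun n hn ↦
    have : Subsingleton (Fin (b n + 1)) := Fin.subsingleton_iff_le_one.2 (by rw [hb n hn])
    Subsingleton.elim _ _

theorem exists_forall_dist_le (U : Prop) {ε : ℝ} (hε : 0 < ε) :
    ∃ b : ℕ → ℕ, (∀ x y : Tree b, dist x y ≤ ε) ∧ (IsDoubling (Tree b) ↔ U) ∧
      ∀ᶠ n in atTop, b n ≠ 0 := by
  classical
  obtain ⟨m, hm⟩ := exists_pow_lt_of_lt_one hε (one_half_lt_one (α := ℝ))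
  let b (n : ℕ) : ℕ := if n < m then 0 else if U then 1 else n + 1
  have hb (n : ℕ) (hn : m ≤ n) : b n = if U then 1 else n + 1 := if_neg hn.not_gt
  refine ⟨b, fun x y ↦ (dist_le_pow (fun n hn ↦ if_pos hn) x y).trans hm.le, ?_, ?_⟩
  · rw [isDoubling_iff]
    refine ⟨fun ⟨B, hB⟩ ↦ ?_, fun hU ↦ ⟨1, forall_mem_range.2 fun n ↦ ?_⟩⟩
    · by_contra hU
      have hle : b (max m B) ≤ B := hB (mem_range_self _)
      rw [hb _ (le_max_left ..), if_neg hU] at hle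
      exact hle.not_gt (Nat.lt_succ_of_le (le_max_right ..))
    · simp only [b, if_pos hU]
      split_ifs <;> simp
  · filter_upwards [eventually_ge_atTop m] with n hn
    rw [hb n hn]
    split_ifs <;> simp

end Tree

/-! ### Adding an isolated point -/

section IsolatedPoint

/-- The space obtained from `X`, embedded as `X × {0}` in `X × ℝ`, by adding the point `(x₀, ρ)`. If
`ρ ≠ 0`, that point is isolated, which destroys uniform perfectness while the other two properties
are unaffected. -/
def withIsolatedPoint {X : Type*} (x₀ : X) (ρ : ℝ) : Set (X × ℝ) := insert (x₀, ρ) (univ ×ˢ {0})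

variable {X : Type*} [MetricSpace X] (x₀ : X) (ρ : ℝ)

theorem isCompact_withIsolatedPoint [CompactSpace X] : IsCompact (withIsolatedPoint x₀ ρ) :=
  (isCompact_univ.prod isCompact_singleton).insert _

theorem exists_isometry_withIsolatedPoint :
    ∃ f : X → withIsolatedPoint x₀ ρ, Isometry f ∧ ∀ y, ∃ x, dist y (f x) ≤ |ρ| := by
  refine ⟨fun x ↦ ⟨(x, 0), .inr ⟨trivial, rfl⟩⟩, isometry_prodMk_left (0 : ℝ), ?_⟩
  rintro ⟨p, rfl | ⟨-, hp⟩⟩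
  · exact ⟨x₀, by simp [Subtype.dist_eq, Prod.dist_eq]⟩
  · exact ⟨p.1, by simp [Subtype.dist_eq, Prod.dist_eq, mem_singleton_iff.1 hp]⟩

theorem exists_isometry_withIsolatedPoint_prod :
    ∃ f : withIsolatedPoint x₀ ρ → X × ({0, ρ} : Set ℝ), Isometry f := by
  have hmem (p : withIsolatedPoint x₀ ρ) : p.1.2 ∈ ({0, ρ} : Set ℝ) := by
    rcases p with ⟨p, rfl | ⟨-, h⟩⟩
    · exact .inr rfl
    · exact .inl h
  exact ⟨fun p ↦ (p.1.1, ⟨p.1.2, hmem p⟩), fun _ _ ↦ rfl⟩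

theorem isDoubling_withIsolatedPoint_iff :
    IsDoubling (withIsolatedPoint x₀ ρ) ↔ IsDoubling X := by
  obtain ⟨f, hf, -⟩ := exists_isometry_withIsolatedPoint x₀ ρ
  obtain ⟨g, hg⟩ := exists_isometry_withIsolatedPoint_prod x₀ ρ
  exact ⟨fun h ↦ h.of_isometry hf, fun h ↦ (h.prod isDoubling_of_finite).of_isometry hg⟩

theorem isUniformlyDisconnected_withIsolatedPoint_iff :
    IsUniformlyDisconnected (withIsolatedPoint x₀ ρ) ↔ IsUniformlyDisconnected X := by
  obtain ⟨f, hf, -⟩ := exists_isometry_withIsolatedPoint x₀ ρ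
  obtain ⟨g, hg⟩ := exists_isometry_withIsolatedPoint_prod x₀ ρ
  exact ⟨fun h ↦ h.of_isometry hf,
    fun h ↦ (h.prod isUniformlyDisconnected_of_finite).of_isometry hg⟩

variable {ρ}

theorem not_isUniformlyPerfect_withIsolatedPoint (hρ : ρ ≠ 0) :
    ¬ IsUniformlyPerfect (withIsolatedPoint x₀ ρ) := by
  let isolated : withIsolatedPoint x₀ ρ := ⟨(x₀, ρ), .inl rfl⟩
  have hopen : IsOpen {isolated} := by
    have hpreimage : {isolated} = (fun p : withIsolatedPoint x₀ ρ ↦ p.1.2) ⁻¹' {0}ᶜ := by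
      ext ⟨p, rfl | ⟨-, hp⟩⟩
      · simpa [isolated] using hρ
      · have hne : p ≠ (x₀, ρ) := fun h ↦ hρ (by rw [← hp, h])
        simpa [isolated, Subtype.ext_iff, hne] using hp
    rw [hpreimage]
    exact isOpen_compl_singleton.preimage (by fun_prop)
  have : Nontrivial (withIsolatedPoint x₀ ρ) :=
    ⟨isolated, ⟨(x₀, 0), .inr ⟨trivial, rfl⟩⟩, fun h ↦ hρ (congrArg (fun p ↦ p.1.2) h)⟩
  exact fun h ↦ h.not_isOpen_singleton isolated hopen

end IsolatedPoint

/-! ### Density -/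

section Density

theorem isDoubling_Icc (a b : ℝ) : IsDoubling (Icc a b) :=
  isDoubling_real.of_isometry isometry_subtype_coe

theorem isUniformlyDisconnected_Icc_iff {a b : ℝ} (hab : a ≤ b) :
    IsUniformlyDisconnected (Icc a b) ↔ a = b := by
  constructor
  · intro h
    have : PreconnectedSpace (Icc a b) := Subtype.preconnectedSpace isPreconnected_Icc
    have := h.subsingleton
    exact congrArg Subtype.val
      (Subsingleton.elim (⟨a, left_mem_Icc.2 hab⟩ : Icc a b) ⟨b, right_mem_Icc.2 hab⟩)
  · rintro rfl
    have : Finite (Icc a a) := by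
      rw [Icc_self]
      infer_instance
    exact isUniformlyDisconnected_of_finite

theorem exists_isUniformlyPerfect_forall_dist_le (U V : Prop) {ε : ℝ} (hε : 0 < ε) :
    ∃ (K : Type) (_ : MetricSpace K) (_ : CompactSpace K) (_ : Nontrivial K),
      (∀ x y : K, dist x y ≤ ε) ∧ (IsDoubling K ↔ U) ∧ (IsUniformlyDisconnected K ↔ V) ∧
        IsUniformlyPerfect K := by
  classical
  obtain ⟨b, hbε, hbU, hb⟩ := Tree.exists_forall_dist_le U hε
  obtain ⟨n, hn⟩ := hb.exists
  have := Tree.nontrivial hn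
  let a : ℝ := if V then 0 else ε
  have ha₀ : 0 ≤ a := by simp only [a]; split_ifs <;> positivity
  have haε : a ≤ ε := by simp only [a]; split_ifs <;> simp [hε.le]
  have : Nonempty (Icc 0 a) := ⟨0, left_mem_Icc.2 ha₀⟩
  refine ⟨Icc 0 a × Tree b, inferInstance, inferInstance, inferInstance, ?_, ?_, ?_, ?_⟩
  · refine fun x y ↦ max_le ?_ (hbε ..)
    exact (Real.dist_le_of_mem_Icc x.1.2 y.1.2).trans (by rwa [sub_zero])
  · rw [isDoubling_prod_iff, hbU]
    exact and_iff_right (isDoubling_Icc ..)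
  · rw [isUniformlyDisconnected_prod_iff, isUniformlyDisconnected_Icc_iff ha₀,
      and_iff_left isUniformlyDisconnected_of_isUltrametricDist]
    simp [a, hε.ne]
  · exact (Tree.isUniformlyPerfect hb).prod

theorem exists_isometry_of_finite.{u} {F : Type u} [MetricSpace F] [Finite F] [Nonempty F]
    (U V W : Prop) {ε : ℝ} (hε : 0 < ε) :
    ∃ (Y : Type u) (_ : MetricSpace Y) (_ : CompactSpace Y) (f : F → Y), Isometry f ∧
      (∀ y, ∃ x, dist y (f x) ≤ ε) ∧
        (IsDoubling Y ↔ U) ∧ (IsUniformlyDisconnected Y ↔ V) ∧ (IsUniformlyPerfect Y ↔ W) := by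
  obtain ⟨K, _, _, _, hKε, hU, hV, hK⟩ := exists_isUniformlyPerfect_forall_dist_le U V (half_pos hε)
  let k₀ : K := Classical.arbitrary K
  let incl : F → F × K := fun x ↦ (x, k₀)
  have hincl : Isometry incl := isometry_prodMk_left k₀
  have hdense (y : F × K) : dist y (incl y.1) ≤ ε / 2 :=
    max_le ((dist_self _).trans_le (half_pos hε).le) (hKε ..)
  have hXU : IsDoubling (F × K) ↔ U := by
    rw [isDoubling_prod_iff, hU, and_iff_right isDoubling_of_finite]
  have hXV : IsUniformlyDisconnected (F × K) ↔ V := by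
    rw [isUniformlyDisconnected_prod_iff, hV, and_iff_right isUniformlyDisconnected_of_finite]
  by_cases hW : W
  · exact ⟨F × K, inferInstance, inferInstance, incl, hincl,
      fun y ↦ ⟨y.1, (hdense y).trans (half_le_self hε.le)⟩, hXU, hXV, iff_of_true hK.prod hW⟩
  · let x₀ : F × K := (Classical.arbitrary F, k₀)
    obtain ⟨f, hf, hfdense⟩ := exists_isometry_withIsolatedPoint x₀ (ε / 2)
    refine ⟨withIsolatedPoint x₀ (ε / 2), inferInstance,
      isCompact_iff_compactSpace.1 (isCompact_withIsolatedPoint ..), f ∘ incl, hf.comp hincl,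
      fun y ↦ ?_, (isDoubling_withIsolatedPoint_iff ..).trans hXU,
      (isUniformlyDisconnected_withIsolatedPoint_iff ..).trans hXV,
      iff_of_false (not_isUniformlyPerfect_withIsolatedPoint x₀ (half_pos hε).ne') hW⟩
    obtain ⟨x, hx⟩ := hfdense y
    rw [abs_of_pos (half_pos hε)] at hx
    refine ⟨x.1, ?_⟩
    calc dist y (f (incl x.1)) ≤ dist y (f x) + dist (f x) (f (incl x.1)) := dist_triangle ..
      _ ≤ ε / 2 + ε / 2 := add_le_add hx ((hf.dist_eq ..).trans_le (hdense x))
      _ = ε := add_halves ε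

variable {X : Type*} [MetricSpace X] [CompactSpace X] [Nonempty X]

theorem toGHSpace_mem_DO : toGHSpace X ∈ DO ↔ IsDoubling X :=
  have ⟨e⟩ := toGHSpace_eq_toGHSpace_iff_isometryEquiv.1 (toGHSpace X).toGHSpace_rep
  isDoubling_congr e

theorem toGHSpace_mem_UD : toGHSpace X ∈ UD ↔ IsUniformlyDisconnected X :=
  have ⟨e⟩ := toGHSpace_eq_toGHSpace_iff_isometryEquiv.1 (toGHSpace X).toGHSpace_rep
  isUniformlyDisconnected_congr e

theorem toGHSpace_mem_UP : toGHSpace X ∈ UP ↔ IsUniformlyPerfect X :=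
  have ⟨e⟩ := toGHSpace_eq_toGHSpace_iff_isometryEquiv.1 (toGHSpace X).toGHSpace_rep
  isUniformlyPerfect_congr e

theorem exists_dist_lt_mem_iff (p : GHSpace) (U V W : Prop) {ε : ℝ} (hε : 0 < ε) :
    ∃ q, dist p q < ε ∧ (q ∈ DO ↔ U) ∧ (q ∈ UD ↔ V) ∧ (q ∈ UP ↔ W) := by
  obtain ⟨F, -, hF, hcover⟩ :=
    finite_cover_balls_of_compact (isCompact_univ (X := p.Rep)) (show 0 < ε / 4 by positivity)
  have hnet (x : p.Rep) : ∃ y ∈ F, dist x y ≤ ε / 4 :=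
    have ⟨y, hy, hxy⟩ := mem_iUnion₂.1 (hcover (mem_univ x))
    ⟨y, hy, (mem_ball.1 hxy).le⟩
  have : Finite F := hF
  have : Nonempty F := have ⟨y, hy, _⟩ := hnet (Classical.arbitrary _); ⟨y, hy⟩
  obtain ⟨Y, _, _, f, hf, hdense, hU, hV, hW⟩ :=
    exists_isometry_of_finite (F := F) U V W (show 0 < ε / 4 by positivity)
  have : Nonempty Y := .map f ‹_›
  refine ⟨toGHSpace Y, ?_, toGHSpace_mem_DO.trans hU, toGHSpace_mem_UD.trans hV,
    toGHSpace_mem_UP.trans hW⟩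
  have hle : ghDist p.Rep Y ≤ ε / 4 + 0 / 2 + ε / 4 :=
    ghDist_le_of_approx_subsets f hnet hdense fun x y ↦ by simp [hf.dist_eq, Subtype.dist_eq]
  rw [ghDist, p.toGHSpace_rep] at hle
  linarith

theorem mem_select_of_iff {Q : Set GHSpace} {u : Fin 3} {q : GHSpace} (h : q ∈ Q ↔ u = 1) :
    q ∈ select Q u := by
  fin_cases u <;> simp_all [select]

theorem dense_typeSet (u v w : Fin 3) : Dense (typeSet u v w) :=
  Metric.dense_iff.2 fun p _ hε ↦
    have ⟨q, hpq, hU, hV, hW⟩ := exists_dist_lt_mem_iff p (u = 1) (v = 1) (w = 1) hε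
    ⟨q, mem_ball'.2 hpq, ⟨mem_select_of_iff hU, mem_select_of_iff hV⟩, mem_select_of_iff hW⟩

end Density

/-! ### Borel complexity -/

section Borel

variable {X : Type*} [TopologicalSpace X] {s t : Set X}

theorem isFsigma_iff_isGδ_compl : IsFsigma s ↔ IsGδ sᶜ := by
  rw [isGδ_iff_eq_iInter_nat]
  constructor
  · rintro ⟨f, hf, rfl⟩
    exact ⟨fun n ↦ (f n)ᶜ, fun n ↦ (hf n).isOpen_compl, compl_iUnion _⟩
  · rintro ⟨f, hf, h⟩
    exact ⟨fun n ↦ (f n)ᶜ, fun n ↦ (hf n).isClosed_compl, by rw [← compl_iInter, ← h, compl_compl]⟩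

theorem isFsigma_univ : IsFsigma (univ : Set X) :=
  ⟨fun _ ↦ univ, fun _ ↦ isClosed_univ, (iUnion_const _).symm⟩

theorem IsFsigma.inter (hs : IsFsigma s) (ht : IsFsigma t) : IsFsigma (s ∩ t) := by
  rw [isFsigma_iff_isGδ_compl] at *
  rw [compl_inter]
  exact hs.union ht

theorem isFsigma_setOf_exists_pos {P : ℝ → X → Prop} (hP : ∀ t > 0, IsClosed {x | P t x})
    (hanti : ∀ ⦃t t' x⦄, P t x → t' ≤ t → P t' x) : IsFsigma {x | ∃ t > 0, P t x} := by
  refine ⟨fun n : ℕ ↦ {x | P (1 / (n + 1)) x}, fun n ↦ hP _ (by positivity), ?_⟩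
  ext x
  simp only [mem_ofPred_eq, mem_iUnion]
  constructor
  · rintro ⟨t, ht, h⟩
    obtain ⟨n, hn⟩ := exists_nat_one_div_lt ht
    exact ⟨n, hanti h hn.le⟩
  · rintro ⟨n, h⟩
    exact ⟨_, by positivity, h⟩

/-- The intersections of an `F_σ` set with a `G_δ` set, a class stable under intersections. In a
metrizable space such sets are both `F_{σδ}` and `G_{δσ}`. -/
def IsFsigmaInterGδ (s : Set X) : Prop :=
  ∃ a b, IsFsigma a ∧ IsGδ b ∧ s = a ∩ b

theorem IsFsigma.isFsigmaInterGδ (hs : IsFsigma s) : IsFsigmaInterGδ s :=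
  ⟨s, univ, hs, .univ, (inter_univ s).symm⟩

theorem isFsigmaInterGδ_of_isGδ (hs : IsGδ s) : IsFsigmaInterGδ s :=
  ⟨univ, s, isFsigma_univ, hs, (univ_inter s).symm⟩

namespace IsFsigmaInterGδ

theorem inter (hs : IsFsigmaInterGδ s) (ht : IsFsigmaInterGδ t) : IsFsigmaInterGδ (s ∩ t) := by
  obtain ⟨a, b, ha, hb, rfl⟩ := hs
  obtain ⟨a', b', ha', hb', rfl⟩ := ht
  exact ⟨a ∩ a', b ∩ b', ha.inter ha', hb.inter hb', inter_inter_inter_comm ..⟩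

variable [PerfectlyNormalSpace X]

theorem isGdeltasigma (hs : IsFsigmaInterGδ s) : IsGdeltasigma s := by
  obtain ⟨_, b, ⟨f, hf, rfl⟩, hb, rfl⟩ := hs
  exact ⟨fun n ↦ f n ∩ b, fun n ↦ (hf n).isGδ.inter hb, iUnion_inter _ _⟩

theorem isFsigmadelta (hs : IsFsigmaInterGδ s) : IsFsigmadelta s := by
  obtain ⟨a, b, ha, hb, rfl⟩ := hs
  obtain ⟨f, hf, rfl⟩ := isGδ_iff_eq_iInter_nat.1 hb
  exact ⟨fun n ↦ a ∩ f n, fun n ↦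
    ha.inter (isFsigma_iff_isGδ_compl.2 (hf n).isClosed_compl.isGδ), inter_iInter _ _⟩

end IsFsigmaInterGδ

end Borel

section TypeSet

theorem isFsigma_DO : IsFsigma DO :=
  ⟨fun N ↦ {p | IsDoublingWith N p.Rep}, isClosed_setOf_isDoublingWith, by
    ext
    simp [DO, IsDoubling]⟩

theorem isFsigma_UD : IsFsigma UD :=
  isFsigma_setOf_exists_pos (fun _ hδ ↦ isClosed_setOf_isUniformlyDisconnectedWith hδ.le)
    fun _ _ _ h hle ↦ h.anti hle

theorem isFsigma_UP : IsFsigma UP := by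
  simp only [UP, isUniformlyPerfect_iff]
  exact isFsigma_setOf_exists_pos (fun c _ ↦ isClosed_setOf_isUniformlyPerfectWith c)
    fun _ _ _ h hle ↦ h.anti hle

variable {Q : Set GHSpace} {u v w : Fin 3}

theorem isFsigma_select (hQ : IsFsigma Q) (hu : u ≠ 0) : IsFsigma (select Q u) := by
  fin_cases u
  · exact absurd rfl hu
  · exact hQ
  · exact isFsigma_univ

theorem isGδ_select (hQ : IsFsigma Q) (hu : u ≠ 1) : IsGδ (select Q u) := by
  fin_cases u
  · exact isFsigma_iff_isGδ_compl.1 hQ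
  · exact absurd rfl hu
  · exact .univ

theorem isFsigmaInterGδ_select (hQ : IsFsigma Q) : IsFsigmaInterGδ (select Q u) := by
  rcases eq_or_ne u 1 with rfl | hu
  · exact (isFsigma_select hQ one_ne_zero).isFsigmaInterGδ
  · exact isFsigmaInterGδ_of_isGδ (isGδ_select hQ hu)

theorem isFsigma_typeSet (h : (0 : Fin 3) ∉ ({u, v, w} : Set (Fin 3))) :
    IsFsigma (typeSet u v w) := by
  obtain ⟨hu, hv, hw⟩ : u ≠ 0 ∧ v ≠ 0 ∧ w ≠ 0 := by simpa [eq_comm] using h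
  exact ((isFsigma_select isFsigma_DO hu).inter (isFsigma_select isFsigma_UD hv)).inter
    (isFsigma_select isFsigma_UP hw)

theorem isGδ_typeSet (h : (1 : Fin 3) ∉ ({u, v, w} : Set (Fin 3))) : IsGδ (typeSet u v w) := by
  obtain ⟨hu, hv, hw⟩ : u ≠ 1 ∧ v ≠ 1 ∧ w ≠ 1 := by simpa [eq_comm] using h
  exact ((isGδ_select isFsigma_DO hu).inter (isGδ_select isFsigma_UD hv)).inter
    (isGδ_select isFsigma_UP hw)

theorem isFsigmaInterGδ_typeSet (u v w : Fin 3) : IsFsigmaInterGδ (typeSet u v w) :=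
  ((isFsigmaInterGδ_select isFsigma_DO).inter (isFsigmaInterGδ_select isFsigma_UD)).inter
    (isFsigmaInterGδ_select isFsigma_UP)

end TypeSet

end GHTypes

theorem mainTheorem2 (u v w : Fin 3) :
    (({u, v, w} : Set (Fin 3)) \ {2} = {1} →
      Dense (GHTypes.typeSet u v w) ∧ GHTypes.IsFsigma (GHTypes.typeSet u v w)) ∧
    (({u, v, w} : Set (Fin 3)) \ {2} = {0} →
      Dense (GHTypes.typeSet u v w) ∧ IsGδ (GHTypes.typeSet u v w)) ∧
    (({u, v, w} : Set (Fin 3)) \ {2} = {0, 1} →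
      Dense (GHTypes.typeSet u v w) ∧ GHTypes.IsFsigmadelta (GHTypes.typeSet u v w) ∧
        GHTypes.IsGdeltasigma (GHTypes.typeSet u v w)) := by
  have hdense := GHTypes.dense_typeSet u v w
  have hBorel := GHTypes.isFsigmaInterGδ_typeSet u v w
  refine ⟨fun h ↦ ⟨hdense, GHTypes.isFsigma_typeSet fun h₀ ↦ ?_⟩,
    fun h ↦ ⟨hdense, GHTypes.isGδ_typeSet fun h₁ ↦ ?_⟩,
    fun _ ↦ ⟨hdense, hBorel.isFsigmadelta, hBorel.isGdeltasigma⟩⟩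
  · have : (0 : Fin 3) ∈ ({1} : Set (Fin 3)) := h ▸ ⟨h₀, by simp⟩
    simp at this
  · have : (1 : Fin 3) ∈ ({0} : Set (Fin 3)) := h ▸ ⟨h₁, by simp⟩
    simp at this
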